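/- For an integer $n\ge 1$ and $p\in[0,1]$, let $\mathcal{G}_{n,p}$ be the random directed graph on $n$ vertices, without self-loops, in which each of the $n(n-1)$ possible arcs is present independently with probability $p$. For a field $\mathbb{F}$ and a directed graph $G$ on $[n]$ without self-loops, a matrix $M\in\mathbb{F}^{n\times n}$ represents $G$ if $M_{i,i}\neq 0$ for every $i$ and $M_{i,j}=0$ whenever $i\neq j$ and $(i,j)$ is not an arc of $G$; let $\mathsf{minrk}_{\mathbb{F}}(G)$ be the minimum of $\mathrm{rank}(M)$ over all matrices $M$ that represent $G$. **Theorem.** For every $\varepsilon>0$ there are constants $C,c>0$, depending only on $\varepsilon$, such that for every field $\mathbb{F}$, every integer $n\ge 1$ and every $p$ with $0<p\le 1-\varepsilon$, $$\Pr\left[\,\mathsf{minrk}_{\mathbb{F}}(\mathcal{G}_{n,p})\le C\cdot\frac{n\log(1/p)}{\log n+\log(1/p)}\,\right]\ \ge\ 1-e^{-cn}.$$ -/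

import Mathlib

/-- A square matrix `M` over `F` indexed by `V` represents the digraph `G` if every diagonal entry
is nonzero and every off-diagonal entry at a non-arc is zero (entries at arcs are arbitrary). -/
def Represents {F V : Type*} [Field F] (M : Matrix V V F) (G : Digraph V) : Prop :=
  (∀ i, M i i ≠ 0) ∧ ∀ i j, i ≠ j → ¬ G.Adj i j → M i j = 0

/-- The identity matrix represents every digraph, so the minimum defining the minrank is taken
over a nonempty set. -/
theorem represents_one {F V : Type*} [Field F] [DecidableEq V] (G : Digraph V) :
    Represents (1 : Matrix V V F) G :=
  ⟨fun i => by simp, fun _ _ hij _ => Matrix.one_apply_ne hij⟩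

/-- The minrank of `G` over `F`: the minimum rank of a matrix over `F` that represents `G`. -/
noncomputable def minrank (F : Type*) {V : Type*} [Field F] [Fintype V] (G : Digraph V) : ℕ :=
  sInf {r : ℕ | ∃ M : Matrix V V F, Represents M G ∧ M.rank = r}

/-- The digraph on `V` with arc set `A`. -/
def digraphOfArcs {V : Type*} (A : Set (V × V)) : Digraph V where
  Adj i j := (i, j) ∈ A

/-- The discrete measurable structure on the finite set of digraphs on `{0, …, n - 1}`. -/
instance digraphMeasurableSpace (n : ℕ) : MeasurableSpace (Digraph (Fin n)) := ⊤

/-- The law of the random digraph on `n` vertices without self-loops in which each of the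
`n * (n - 1)` possible arcs is present independently with probability `p`. -/
noncomputable def directedGnp (n : ℕ) (p : unitInterval) :
    MeasureTheory.Measure (Digraph (Fin n)) :=
  (ProbabilityTheory.setBernoulli {e : Fin n × Fin n | e.1 ≠ e.2} p).map digraphOfArcs

instance directedGnp_isProbabilityMeasure (n : ℕ) (p : unitInterval) :
    MeasureTheory.IsProbabilityMeasure (directedGnp n p) :=
  MeasureTheory.Measure.isProbabilityMeasure_map (Measurable.of_discrete).aemeasurable

/-! A partition of the vertices into `r` classes, any two distinct vertices of a class being joined
by arcs in both directions, gives a representing matrix of rank at most `r` over every field: the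
block matrix whose `(i, j)` entry is `1` exactly when `i` and `j` lie in the same class
(`minrank_le_of_clique_partition`). So it suffices to partition the random digraph into few cliques
of its graph of mutual arcs, in which a pair is an edge with probability `q = p ^ 2`.

With probability at least `1 - exp (-n)`, every vertex set `S` with at least `n ^ (3 / 4)` elements
spans more than a quarter of the expected number of mutual pairs
(`setBernoulli_real_isMutuallyDense_ge`): the lower tail of that number is at most
`exp (-q * |S| * (|S| - 1) / 8)`, which beats a union bound over the `2 ^ n` sets as soon as `p` is
not polynomially small. The tail bound is Chernoff's argument applied to `(1 / 2) ^ X`.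

On this event everything is deterministic. Every such `S` has a vertex adjacent to a proportion
`q / 16` of `S`; passing repeatedly to the neighbourhood of such a vertex produces, in any set with
`n ^ (7 / 8)` elements, a clique of size `k`, where `k` is a constant multiple of
`log n / log (1 / p)` (`exists_clique_of_dense`). Removing such cliques as long as possible and
taking singletons at the end partitions the vertices into at most `n / k + n ^ (7 / 8)` cliques
(`exists_clique_partition`), which is of the required order because `log (1 / p)` is bounded below
in terms of `ε`.

When `n` is bounded, or when `p` is polynomially small in `n`, the claimed bound exceeds `n` for a
suitable constant, and the identity matrix suffices. -/

open MeasureTheory ProbabilityTheory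

/-! ### Lower tail for disjoint blocks in a binomial random set -/

theorem setBernoulli_real_superset {ι : Type*} [Countable ι] {u : Set ι} (p : unitInterval)
    {W : Finset ι} (hW : (W : Set ι) ⊆ u) :
    (setBernoulli u p).real {A | (W : Set ι) ⊆ A} = (p : ℝ) ^ W.card := by
  have hpre : (fun P : ι → Prop ↦ {i | P i}) ⁻¹' {A | (W : Set ι) ⊆ A}
      = Set.pi W (fun _ ↦ {True}) := by
    ext P
    simp [Set.subset_def, Set.mem_pi]
  rw [measureReal_def, setBernoulli_apply', hpre,
    Measure.infinitePi_pi _ (fun _ _ ↦ MeasurableSet.of_discrete)]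
  rw [Finset.prod_congr rfl (g := fun _ ↦ (unitInterval.toNNReal p : ENNReal))]
  · simp
  · intro i hi
    have hiu : i ∈ u := hW hi
    simp [hiu]

/-- The expectation of `(1 / 2) ^ X`, where `X` counts the blocks `B k`, disjoint and of size `b`,
that are contained in the random set. Expanding the product reduces independence of the blocks to
the probability that the union of a subfamily is contained in the random set. -/
theorem integral_prod_one_sub_half_blocks {ι κ : Type*} [Finite ι] {u : Set ι} (p : unitInterval)
    (T : Finset κ) (B : κ → Finset ι) (hu : ∀ k ∈ T, (B k : Set ι) ⊆ u)
    (hB : (T : Set κ).PairwiseDisjoint B) {b : ℕ} (hcard : ∀ k ∈ T, (B k).card = b) :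
    ∫ A, ∏ k ∈ T, (1 - {A : Set ι | (B k : Set ι) ⊆ A}.indicator (fun _ ↦ (1 / 2 : ℝ)) A)
      ∂(setBernoulli u p) = (1 - (p : ℝ) ^ b / 2) ^ T.card := by
  classical
  have hexp (A : Set ι) :
      ∏ k ∈ T, (1 - {A : Set ι | (B k : Set ι) ⊆ A}.indicator (fun _ ↦ (1 / 2 : ℝ)) A)
        = ∑ U ∈ T.powerset, {A : Set ι | ((U.biUnion B : Finset ι) : Set ι) ⊆ A}.indicator
            (fun _ ↦ (-(1 / 2) : ℝ) ^ U.card) A := by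
    simp_rw [sub_eq_add_neg, Finset.prod_one_add]
    refine Finset.sum_congr rfl fun U _ ↦ ?_
    by_cases h : ((U.biUnion B : Finset ι) : Set ι) ⊆ A
    · rw [Set.indicator_of_mem (by exact h), ← Finset.prod_const]
      refine Finset.prod_congr rfl fun k hk ↦ ?_
      rw [Set.indicator_of_mem]
      exact (Finset.coe_subset.2 (Finset.subset_biUnion_of_mem B hk)).trans h
    · rw [Set.indicator_of_notMem (by exact h)]
      have : ∃ k ∈ U, ¬ (B k : Set ι) ⊆ A := by
        by_contra! h'
        exact h (by simpa using h')
      obtain ⟨k, hk, hkA⟩ := this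
      refine Finset.prod_eq_zero hk ?_
      rw [Set.indicator_of_notMem (by exact hkA), neg_zero]
  simp_rw [hexp]
  rw [integral_finsetSum _ (fun _ _ ↦ (integrable_const _).indicator MeasurableSet.of_discrete)]
  have hterm : ∀ U ∈ T.powerset, ∫ A, {A : Set ι | ((U.biUnion B : Finset ι) : Set ι) ⊆ A}.indicator
            (fun _ ↦ (-(1 / 2) : ℝ) ^ U.card) A ∂(setBernoulli u p)
        = ∏ k ∈ U, (-((p : ℝ) ^ b / 2)) := by
    intro U hU
    rw [Finset.mem_powerset] at hU
    rw [integral_indicator_const _ MeasurableSet.of_discrete, setBernoulli_real_superset,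
      Finset.card_biUnion (fun i hi j hj hij ↦ hB (hU hi) (hU hj) hij),
      Finset.sum_congr rfl (fun k hk ↦ hcard k (hU hk))]
    · simp only [Finset.sum_const, smul_eq_mul, Finset.prod_const]
      rw [mul_comm U.card, pow_mul, ← mul_pow]
      ring
    · simpa using fun k hk ↦ hu k (hU hk)
  rw [Finset.sum_congr rfl hterm, ← Finset.prod_one_add, Finset.prod_const, sub_eq_add_neg]

/-- Chernoff bound for the lower tail of the number of blocks contained in the random set, at a
quarter of the mean. -/
theorem setBernoulli_real_card_blocks_le {ι κ : Type*} [Finite ι] {u : Set ι} (p : unitInterval)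
    (T : Finset κ) (B : κ → Finset ι) (hu : ∀ k ∈ T, (B k : Set ι) ⊆ u)
    (hB : (T : Set κ).PairwiseDisjoint B) {b : ℕ} (hcard : ∀ k ∈ T, (B k).card = b) :
    (setBernoulli u p).real
      {A | ({k ∈ (T : Set κ) | (B k : Set ι) ⊆ A}.ncard : ℝ) ≤ (p : ℝ) ^ b * T.card / 4}
      ≤ Real.exp (-((p : ℝ) ^ b * T.card / 4)) := by
  classical
  set x : ℝ := (p : ℝ) ^ b * T.card / 4 with hx
  set f : Set ι → ℝ := fun A ↦
    ∏ k ∈ T, (1 - {A : Set ι | (B k : Set ι) ⊆ A}.indicator (fun _ ↦ (1 / 2 : ℝ)) A) with hf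
  have hfA (A : Set ι) : f A = (1 / 2 : ℝ) ^ {k ∈ (T : Set κ) | (B k : Set ι) ⊆ A}.ncard := by
    have : {k ∈ (T : Set κ) | (B k : Set ι) ⊆ A}
        = ((T.filter fun k ↦ (B k : Set ι) ⊆ A : Finset κ) : Set κ) := by
      ext; simp
    rw [this, Set.ncard_coe_finset, ← Finset.prod_const, Finset.prod_filter]
    refine Finset.prod_congr rfl fun k _ ↦ ?_
    by_cases h : (B k : Set ι) ⊆ A
    · rw [Set.indicator_of_mem (by exact h), if_pos h]; norm_num
    · rw [Set.indicator_of_notMem (by exact h), if_neg h, sub_zero]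
  have hhalf : Real.exp (-1) ≤ 1 / 2 := by
    rw [Real.exp_neg, one_div]
    exact inv_anti₀ two_pos (by linarith [Real.add_one_le_exp 1])
  have hmarkov := mul_meas_ge_le_integral_of_nonneg (μ := setBernoulli u p) (f := f)
    (Filter.Eventually.of_forall fun A ↦ by rw [hfA]; positivity) (Integrable.of_finite)
    (Real.exp (-x))
  have hint : ∫ A, f A ∂(setBernoulli u p) ≤ Real.exp (-(2 * x)) := by
    rw [hf, integral_prod_one_sub_half_blocks p T B hu hB hcard]
    have h1 : 1 - (p : ℝ) ^ b / 2 ≤ Real.exp (-((p : ℝ) ^ b / 2)) := by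
      linarith [Real.add_one_le_exp (-((p : ℝ) ^ b / 2))]
    have h0 : 0 ≤ 1 - (p : ℝ) ^ b / 2 := by
      linarith [pow_le_one₀ p.2.1 p.2.2 (n := b)]
    refine (pow_le_pow_left₀ h0 h1 _).trans_eq ?_
    rw [← Real.exp_nat_mul]
    congr 1
    rw [hx]; ring
  have hsub : (setBernoulli u p).real
      {A | ({k ∈ (T : Set κ) | (B k : Set ι) ⊆ A}.ncard : ℝ) ≤ x}
      ≤ (setBernoulli u p).real {A | Real.exp (-x) ≤ f A} := by
    refine measureReal_mono fun A hA ↦ ?_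
    simp only [Set.mem_ofPred_eq] at hA ⊢
    rw [hfA]
    refine le_trans ?_ (pow_le_pow_left₀ (Real.exp_pos _).le hhalf _)
    rw [← Real.exp_nat_mul]
    exact Real.exp_le_exp.2 (by linarith)
  refine hsub.trans ?_
  have h2 : Real.exp (-(2 * x)) = Real.exp (-x) * Real.exp (-x) := by
    rw [← Real.exp_add]; congr 1; ring
  rw [h2] at hint
  exact le_of_mul_le_mul_left (hmarkov.trans hint) (Real.exp_pos _)

/-! ### Minrank and partitions into cliques -/

theorem minrank_le_of_clique_partition (F : Type*) [Field F] {V : Type*} [Fintype V]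
    (G : Digraph V) {r : ℕ} (f : V → ℕ) (hfr : ∀ i, f i < r)
    (hf : ∀ i j, i ≠ j → f i = f j → G.Adj i j) : minrank F G ≤ r := by
  classical
  let P : Matrix V (Fin r) F := Matrix.of fun i a ↦ if f i = a then 1 else 0
  have hM : ∀ i j, (P * P.transpose) i j = if f i = f j then 1 else 0 := by
    intro i j
    rw [Matrix.mul_apply, Finset.sum_eq_single (⟨f i, hfr i⟩ : Fin r)]
    · simp [P, eq_comm]
    · intro a _ ha
      have : f i ≠ a := fun h ↦ ha (Fin.ext h.symm)
      simp [P, this]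
    · simp
  have hrep : Represents (P * P.transpose) G := by
    refine ⟨fun i ↦ by simp [hM], fun i j hij hadj ↦ ?_⟩
    rw [hM, if_neg fun h ↦ hadj (hf i j hij h)]
  calc minrank F G ≤ (P * P.transpose).rank := Nat.sInf_le ⟨_, hrep, rfl⟩
    _ ≤ P.rank := Matrix.rank_mul_le_left _ _
    _ ≤ r := by simpa using P.rank_le_card_width

theorem minrank_le_card (F : Type*) [Field F] {V : Type*} [Fintype V] (G : Digraph V) :
    minrank F G ≤ Fintype.card V := by
  classical
  exact Nat.sInf_le ⟨1, represents_one G, Matrix.rank_one⟩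

/-- Greedy removal of cliques of size `k` from `S` until fewer than `s₀` vertices are left, which
become singletons. The partition is encoded by a labelling `f` with labels below `r`. -/
theorem exists_clique_partition {V : Type*} {H : SimpleGraph V} {k : ℕ} (hk : 0 < k) {s₀ : ℝ}
    (hclique : ∀ S : Finset V, s₀ ≤ S.card → ∃ K ⊆ S, K.card = k ∧ H.IsClique K)
    (S : Finset V) :
    ∃ (r : ℕ) (f : V → ℕ), (∀ i ∈ S, f i < r) ∧
      (∀ i ∈ S, ∀ j ∈ S, i ≠ j → f i = f j → H.Adj i j) ∧ (k * r : ℝ) ≤ S.card + k * s₀ := by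
  classical
  induction S using Finset.strongInduction with
  | H S ih =>
    by_cases hS : s₀ ≤ S.card
    · obtain ⟨K, hKS, hKk, hK⟩ := hclique S hS
      have hss : S \ K ⊂ S := by
        refine Finset.sdiff_ssubset hKS ?_
        rw [← Finset.card_pos]; omega
      obtain ⟨r, f, hfr, hf, hr⟩ := ih _ hss
      refine ⟨r + 1, fun i ↦ if i ∈ K then r else f i, fun i hi ↦ ?_, fun i hi j hj hij h ↦ ?_, ?_⟩
      · by_cases hiK : i ∈ K
        · simp [hiK]
        · simpa [hiK] using (hfr i (by simp [hi, hiK])).trans (Nat.lt_succ_self r)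
      · have hfi : i ∉ K → f i < r := fun h ↦ hfr i (by simp [hi, h])
        have hfj : j ∉ K → f j < r := fun h ↦ hfr j (by simp [hj, h])
        by_cases hiK : i ∈ K <;> by_cases hjK : j ∈ K <;> simp only [hiK, hjK, if_true, if_false] at h
        · exact hK hiK hjK hij
        · exact absurd h.symm (hfj hjK).ne
        · exact absurd h (hfi hiK).ne
        · exact hf i (by simp [hi, hiK]) j (by simp [hj, hjK]) hij h
      · have hc : ((S \ K).card : ℝ) + k = S.card := by
          rw [← hKk]; exact_mod_cast Finset.card_sdiff_add_card_eq_card hKS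
        push_cast
        linarith
    · obtain ⟨f, hf⟩ : ∃ f : V → ℕ, (∀ i ∈ S, f i < S.card) ∧ Set.InjOn f S := by
        refine ⟨fun i ↦ if h : i ∈ S then S.equivFin ⟨i, h⟩ else 0, fun i hi ↦ by simp [hi], ?_⟩
        intro i hi j hj hij
        simp only [Finset.mem_coe] at hi hj
        simpa [hi, hj, Fin.val_inj] using hij
      refine ⟨S.card, f, hf.1, fun i hi j hj hij h ↦ absurd (hf.2 hi hj h) hij, ?_⟩
      have : (k : ℝ) * S.card ≤ k * s₀ := by gcongr; linarith
      have : (0 : ℝ) ≤ S.card := by positivity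
      linarith

/-- The clique is built one vertex at a time, inside the successive neighbourhoods. The hypothesis
`hS` ensures that these all have at least `m` elements. -/
theorem exists_clique_of_dense {V : Type*} [DecidableEq V] {H : SimpleGraph V} [DecidableRel H.Adj]
    {α m : ℝ} (hα : 0 ≤ α) (hα1 : α ≤ 1)
    (hdeg : ∀ S : Finset V, m ≤ S.card → ∃ v ∈ S, α * S.card ≤ (S.filter (H.Adj v)).card)
    (k : ℕ) (S : Finset V) (hS : m ≤ α ^ k * S.card) :
    ∃ K ⊆ S, K.card = k ∧ H.IsClique K := by
  induction k generalizing S with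
  | zero => exact ⟨∅, by simp, by simp, by simp⟩
  | succ k ih =>
    have hmS : m ≤ S.card :=
      hS.trans (mul_le_of_le_one_left (by positivity) (pow_le_one₀ hα hα1))
    obtain ⟨v, hv, hd⟩ := hdeg S hmS
    obtain ⟨K, hKS, hKk, hK⟩ := ih (S.filter (H.Adj v)) <| hS.trans <| by
      rw [pow_succ, mul_assoc]; gcongr
    have hadj : ∀ w ∈ K, H.Adj v w := fun w hw ↦ (Finset.mem_filter.1 (hKS hw)).2
    refine ⟨insert v K, ?_, ?_, ?_⟩
    · exact Finset.insert_subset hv (hKS.trans (Finset.filter_subset _ _))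
    · rw [Finset.card_insert_of_notMem fun h ↦ H.loopless.irrefl v (hadj v h), hKk]
    · rw [Finset.coe_insert, SimpleGraph.isClique_insert]
      exact ⟨hK, fun w hw _ ↦ hadj w hw⟩

/-! ### Arc sets with many mutual pairs -/

/-- The simple graph in which two vertices are adjacent if the arc set `A` contains the arcs between
them in both directions. -/
def mutualGraph {V : Type*} (A : Set (V × V)) : SimpleGraph V where
  Adj i j := i ≠ j ∧ (i, j) ∈ A ∧ (j, i) ∈ A
  symm := ⟨fun _ _ h ↦ ⟨h.1.symm, h.2.2, h.2.1⟩⟩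
  loopless := ⟨fun _ h ↦ h.1 rfl⟩

/-- The pairs of elements of `S` in increasing order, one for each two-element subset of `S`. -/
def orderedPairs {V : Type*} [LinearOrder V] (S : Finset V) : Finset (V × V) :=
  (S ×ˢ S).filter fun x ↦ x.1 < x.2

theorem mem_orderedPairs {V : Type*} [LinearOrder V] {S : Finset V} {x : V × V} :
    x ∈ orderedPairs S ↔ (x.1 ∈ S ∧ x.2 ∈ S) ∧ x.1 < x.2 := by
  simp [orderedPairs]

theorem card_orderedPairs {V : Type*} [LinearOrder V] (S : Finset V) :
    ((orderedPairs S).card : ℝ) = S.card * (S.card - 1) / 2 := by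
  have hunion : S.offDiag = orderedPairs S ∪ (orderedPairs S).image Prod.swap := by
    ext ⟨a, b⟩
    simp only [Finset.mem_offDiag, Finset.mem_union, mem_orderedPairs, Finset.mem_image,
      Prod.exists, Prod.swap_prod_mk, Prod.mk.injEq]
    constructor
    · rintro ⟨ha, hb, hab⟩
      rcases lt_or_gt_of_ne hab with h | h
      · exact Or.inl ⟨⟨ha, hb⟩, h⟩
      · exact Or.inr ⟨b, a, ⟨⟨hb, ha⟩, h⟩, rfl, rfl⟩
    · rintro (⟨⟨ha, hb⟩, h⟩ | ⟨c, d, ⟨⟨hc, hd⟩, h⟩, rfl, rfl⟩)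
      · exact ⟨ha, hb, h.ne⟩
      · exact ⟨hd, hc, h.ne'⟩
  have hdisj : Disjoint (orderedPairs S) ((orderedPairs S).image Prod.swap) := by
    rw [Finset.disjoint_left]
    rintro x hx hx'
    obtain ⟨y, hy, rfl⟩ := Finset.mem_image.1 hx'
    exact lt_asymm (mem_orderedPairs.1 hx).2 (mem_orderedPairs.1 hy).2
  have h := congrArg Finset.card hunion
  rw [Finset.card_union_of_disjoint hdisj, Finset.card_image_of_injective _ Prod.swap_injective,
    Finset.offDiag_card] at h
  have h2 : S.card * S.card = 2 * (orderedPairs S).card + S.card := by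
    have := Nat.le_mul_self S.card
    omega
  have h3 : (S.card * S.card : ℝ) = 2 * (orderedPairs S).card + S.card := by exact_mod_cast h2
  linarith

/-- The two arcs between the endpoints of `x`, which collapse to one if the endpoints agree. -/
def arcPair {V : Type*} [DecidableEq V] (x : V × V) : Finset (V × V) := {x, x.swap}

/-- Every vertex set `S` with at least `m` elements spans more than `q / 4` times its number of pairs
as mutual pairs of the arc set `A`. -/
def IsMutuallyDense {V : Type*} [LinearOrder V] (q m : ℝ) (A : Set (V × V)) : Prop :=
  ∀ S : Finset V, m ≤ S.card → q * (orderedPairs S).card / 4 <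
    ({x ∈ (orderedPairs S : Set (V × V)) | (arcPair x : Set (V × V)) ⊆ A}.ncard : ℝ)

/-- Average degree. Each mutual pair is counted only at its smaller endpoint, which is where a factor
of two is given away. -/
theorem IsMutuallyDense.exists_degree_ge {V : Type*} [LinearOrder V] {q m : ℝ} {A : Set (V × V)}
    [DecidableRel (mutualGraph A).Adj] (hq : 0 ≤ q)
    (hm : 2 ≤ m) (h : IsMutuallyDense q m A) (S : Finset V) (hS : m ≤ S.card) :
    ∃ v ∈ S, q / 16 * S.card ≤ (S.filter ((mutualGraph A).Adj v)).card := by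
  by_contra! hdeg
  have hsub : {x ∈ (orderedPairs S : Set (V × V)) | (arcPair x : Set (V × V)) ⊆ A}
      ⊆ ((S.sigma fun v ↦ S.filter ((mutualGraph A).Adj v)).image
          (fun x ↦ (x.1, x.2)) : Finset (V × V)) := by
    rintro ⟨a, b⟩ ⟨hab, hA⟩
    rw [Finset.mem_coe, mem_orderedPairs] at hab
    have hA1 : (a, b) ∈ A := hA (by simp [arcPair])
    have hA2 : (b, a) ∈ A := hA (by simp [arcPair])
    simp only [Finset.coe_image, Set.mem_image, Finset.mem_coe, Finset.mem_sigma,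
      Finset.mem_filter]
    exact ⟨⟨a, b⟩, ⟨hab.1.1, hab.1.2, hab.2.ne, hA1, hA2⟩, rfl⟩
  have hcard := (Set.ncard_le_ncard hsub (Finset.finite_toSet _)).trans_eq (Set.ncard_coe_finset _)
  have hcard' := hcard.trans Finset.card_image_le
  rw [Finset.card_sigma] at hcard'
  have hsum : ((∑ v ∈ S, (S.filter ((mutualGraph A).Adj v)).card : ℕ) : ℝ)
      ≤ S.card * (q / 16 * S.card) := by
    push_cast
    rw [← nsmul_eq_mul]
    exact Finset.sum_le_card_nsmul _ _ _ fun v hv ↦ (hdeg v hv).le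
  have hlt := (h S hS).trans_le ((Nat.cast_le.2 hcard').trans hsum)
  rw [card_orderedPairs] at hlt
  have hs : (2 : ℝ) ≤ S.card := hm.trans hS
  have : 0 ≤ q * (S.card * (S.card - 2) : ℝ) := by
    have : (0 : ℝ) ≤ S.card - 2 := by linarith
    positivity
  nlinarith

theorem IsMutuallyDense.minrank_le (F : Type*) [Field F] {n : ℕ} {q m : ℝ}
    {A : Set (Fin n × Fin n)} (h : IsMutuallyDense q m A) (hq : 0 ≤ q) (hq1 : q ≤ 1)
    (hm : 2 ≤ m) {k : ℕ} (hk : 0 < k) {s₀ : ℝ} (hs₀ : m ≤ (q / 16) ^ k * s₀) :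
    (minrank F (digraphOfArcs A) : ℝ) ≤ n / k + s₀ := by
  classical
  obtain ⟨r, f, hfr, hf, hr⟩ := exists_clique_partition (H := mutualGraph A) hk (s₀ := s₀)
    (fun S hS ↦ exists_clique_of_dense (by positivity) (by linarith)
      (h.exists_degree_ge hq hm) k S (hs₀.trans (by gcongr))) Finset.univ
  have hmin : minrank F (digraphOfArcs A) ≤ r :=
    minrank_le_of_clique_partition F _ f (fun i ↦ hfr i (Finset.mem_univ i)) fun i j hij hfij ↦
      (hf i (Finset.mem_univ i) j (Finset.mem_univ j) hij hfij).2.1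
  refine (Nat.cast_le.2 hmin).trans ?_
  rw [Finset.card_univ, Fintype.card_fin] at hr
  have hk' : (0 : ℝ) < k := by exact_mod_cast hk
  rw [← sub_nonneg] at hr ⊢
  have : (n : ℝ) / k + s₀ - r = (n + k * s₀ - k * r) / k := by field_simp
  rw [this]
  positivity

/-! ### Density of the random digraph -/

theorem pairwiseDisjoint_arcPair {V : Type*} [LinearOrder V] (S : Finset V) :
    (orderedPairs S : Set (V × V)).PairwiseDisjoint arcPair := by
  intro x hx y hy hxy
  have hx' := (mem_orderedPairs.1 hx).2
  have hy' := (mem_orderedPairs.1 hy).2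
  rw [Function.onFun, Finset.disjoint_left]
  intro z hz hz'
  simp only [arcPair, Finset.mem_insert, Finset.mem_singleton] at hz hz'
  rcases hz with rfl | rfl <;> rcases hz' with h | h
  · exact hxy h
  · subst h; exact lt_asymm hx' hy'
  · rw [← h] at hy'; exact lt_asymm hx' hy'
  · exact hxy (Prod.swap_injective h)

/-- Union bound over all vertex sets. The hypothesis `hpm` makes each of the at most `2 ^ n` failure
probabilities at most `exp (-2 * n)`. -/
theorem setBernoulli_real_isMutuallyDense_ge {n : ℕ} (p : unitInterval) {m : ℝ} (hm : 2 ≤ m)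
    (hpm : 2 * (n : ℝ) ≤ (p : ℝ) ^ 2 * m ^ 2 / 16) :
    1 - Real.exp (-n) ≤ (setBernoulli {e : Fin n × Fin n | e.1 ≠ e.2} p).real
      {A | IsMutuallyDense ((p : ℝ) ^ 2) m A} := by
  classical
  set μ := setBernoulli {e : Fin n × Fin n | e.1 ≠ e.2} p
  let bad (S : Finset (Fin n)) : Set (Set (Fin n × Fin n)) :=
    {A | ({x ∈ (orderedPairs S : Set (Fin n × Fin n)) |
      (arcPair x : Set (Fin n × Fin n)) ⊆ A}.ncard : ℝ) ≤
        (p : ℝ) ^ 2 * (orderedPairs S).card / 4}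
  have hbad : ∀ S : Finset (Fin n), m ≤ S.card → μ.real (bad S) ≤ Real.exp (-(2 * n)) := by
    intro S hS
    refine (setBernoulli_real_card_blocks_le p (orderedPairs S) arcPair ?_
      (pairwiseDisjoint_arcPair S) ?_).trans (Real.exp_le_exp.2 (neg_le_neg ?_))
    · intro x hx
      have := (mem_orderedPairs.1 hx).2
      simp [arcPair, Set.insert_subset_iff, this.ne, this.ne']
    · intro x hx
      refine Finset.card_pair fun h ↦ (mem_orderedPairs.1 hx).2.ne ?_
      exact congrArg Prod.fst h
    · refine hpm.trans ?_
      rw [card_orderedPairs]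
      have hmS : m ^ 2 / 4 ≤ (S.card * (S.card - 1) / 2 : ℝ) := by nlinarith
      have := mul_le_mul_of_nonneg_left hmS (sq_nonneg (p : ℝ))
      linarith
  have hcompl : {A | IsMutuallyDense ((p : ℝ) ^ 2) m A}ᶜ ⊆
      ⋃ S ∈ Finset.univ.filter (fun S : Finset (Fin n) ↦ m ≤ S.card), bad S := by
    intro A hA
    simp only [IsMutuallyDense, Set.mem_compl_iff, Set.mem_ofPred_eq, not_forall, not_lt] at hA
    obtain ⟨S, hS, hA⟩ := hA
    simp only [Set.mem_iUnion]
    exact ⟨S, by simpa using hS, hA⟩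
  have hle : μ.real {A | IsMutuallyDense ((p : ℝ) ^ 2) m A}ᶜ ≤ Real.exp (-n) := by
    calc _ ≤ _ := measureReal_mono hcompl (measure_ne_top _ _)
      _ ≤ _ := measureReal_biUnion_finset_le _ _
      _ ≤ (Finset.univ.filter (fun S : Finset (Fin n) ↦ m ≤ S.card)).card •
            Real.exp (-(2 * n)) :=
          Finset.sum_le_card_nsmul _ _ _ fun S hS ↦ hbad S (Finset.mem_filter.1 hS).2
      _ ≤ 2 ^ n * Real.exp (-(2 * n)) := by
          rw [nsmul_eq_mul]
          gcongr
          exact_mod_cast (Finset.card_filter_le _ _).trans_eq (by simp)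
      _ ≤ Real.exp n * Real.exp (-(2 * n)) := by
          gcongr
          rw [← mul_one (n : ℝ), Real.exp_nat_mul]
          gcongr
          linarith [Real.add_one_le_exp 1]
      _ = Real.exp (-n) := by rw [← Real.exp_add]; congr 1; ring
  rw [measureReal_compl MeasurableSet.of_discrete, probReal_univ] at hle
  linarith

/-! ### Parameters -/

/-- The choice `m = n ^ (3 / 4)`, `s₀ = n ^ (7 / 8)`, `k = ⌊log n / (8 * D * L)⌋` for the greedy
argument, where `L` stands for `log (1 / p)`. The constant `D` is such that
`log (16 / p ^ 2) ≤ D * L`, so that `k` neighbourhood steps cost a factor of at most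
`n ^ (1 / 8)`. The lower bound on `n` makes `n ^ (3 / 8)` at least `32`. -/
theorem exists_greedy_parameters {lam L n D : ℝ} (hlam : 0 < lam) (hL : lam ≤ L)
    (hD : D = 2 + Real.log 16 / lam) (hn : 2 ^ 14 ≤ n) (hnL : 8 * D * L ≤ Real.log n) :
    ∃ (m s₀ : ℝ) (k : ℕ), 2 ≤ m ∧ 0 < k ∧
      2 * n ≤ Real.exp (-L) ^ 2 * m ^ 2 / 16 ∧ m ≤ (Real.exp (-L) ^ 2 / 16) ^ k * s₀ ∧
      n / k + s₀ ≤ (32 * D + 16 / lam) * (n * L / (Real.log n + L)) := by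
  have hL0 : 0 < L := hlam.trans_le hL
  have hn0 : 0 < n := by linarith [show (0 : ℝ) < 2 ^ 14 by positivity]
  have hlog16D : Real.log 16 ≤ (D - 2) * L := by
    have : D - 2 = Real.log 16 / lam := by rw [hD]; ring
    rw [this, div_mul_eq_mul_div, le_div_iff₀ hlam]
    exact mul_le_mul_of_nonneg_left hL (Real.log_nonneg (by norm_num))
  have hD2 : 2 ≤ D := by
    have : 0 ≤ Real.log 16 / lam := div_nonneg (Real.log_nonneg (by norm_num)) hlam.le
    linarith
  have hDL : 2 * L ≤ D * L := by gcongr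
  have hx1 : 1 ≤ Real.log n / (8 * D * L) := by rw [le_div_iff₀] <;> linarith
  have hk : 0 < ⌊Real.log n / (8 * D * L)⌋₊ := Nat.floor_pos.2 hx1
  set k : ℕ := ⌊Real.log n / (8 * D * L)⌋₊ with hk_def
  have hk' : (0 : ℝ) < k := by exact_mod_cast hk
  have hkle : (k : ℝ) * (8 * D * L) ≤ Real.log n := by
    rw [← le_div_iff₀ (by linarith)]; exact Nat.floor_le (by linarith)
  have hkge : Real.log n ≤ k * (16 * D * L) := by
    have h1 : Real.log n / (8 * D * L) < k + 1 := Nat.lt_floor_add_one _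
    have h2 : (1 : ℝ) ≤ k := by exact_mod_cast hk
    rw [div_lt_iff₀ (by linarith)] at h1
    have := mul_le_mul_of_nonneg_right h2 (show 0 ≤ 8 * D * L by linarith)
    linarith
  have h16L : 16 * L ≤ Real.log n := by linarith
  have hlogpos : 0 < Real.log n := by linarith
  have hrpow : ∀ a : ℝ, n ^ a = Real.exp (Real.log n * a) := Real.rpow_def_of_pos hn0
  have hpow : ∀ a b : ℝ, 0 ≤ a → b ≤ 14 * a → (2 : ℝ) ^ b ≤ n ^ a := by
    intro a b ha hb
    refine le_trans ?_ (Real.rpow_le_rpow (by positivity) hn ha)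
    rw [← Real.rpow_natCast, ← Real.rpow_mul (by norm_num)]
    exact Real.rpow_le_rpow_of_exponent_le (by norm_num) (by exact_mod_cast hb)
  refine ⟨n ^ (3 / 4 : ℝ), n ^ (7 / 8 : ℝ), k, ?_, hk, ?_, ?_, ?_⟩
  · simpa using hpow (3 / 4) 1 (by norm_num) (by norm_num)
  · have h32 : (32 : ℝ) ≤ n ^ (3 / 8 : ℝ) := by
      have := hpow (3 / 8) 5 (by norm_num) (by norm_num)
      norm_num at this ⊢
      exact this
    have h1 : n ^ (3 / 8 : ℝ) * n ≤ Real.exp (-L) ^ 2 * (n ^ (3 / 4 : ℝ)) ^ 2 := by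
      have h2 : n ^ (3 / 8 : ℝ) * n = Real.exp (Real.log n * (3 / 8) + Real.log n) := by
        rw [Real.exp_add, ← hrpow, Real.exp_log hn0]
      rw [h2, hrpow, ← Real.exp_nat_mul, ← Real.exp_nat_mul, ← Real.exp_add]
      refine Real.exp_le_exp.2 ?_
      push_cast
      linarith
    have h3 := mul_le_mul_of_nonneg_right h32 hn0.le
    linarith
  · have h16 : Real.exp (-L) ^ 2 / 16 = Real.exp (-(2 * L + Real.log 16)) := by
      rw [neg_add, Real.exp_add, Real.exp_neg (Real.log 16), Real.exp_log (by norm_num),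
        ← Real.exp_nat_mul]
      push_cast
      rw [mul_neg, div_eq_mul_inv]
    rw [h16, hrpow, hrpow, ← Real.exp_nat_mul, ← Real.exp_add]
    refine Real.exp_le_exp.2 ?_
    have : k * (2 * L + Real.log 16) ≤ k * (D * L) := by gcongr; linarith
    linarith
  · have h1 : n / k ≤ 16 * D * (n * L / Real.log n) := by
      rw [← mul_div_assoc, div_le_div_iff₀ hk' hlogpos]
      have := mul_le_mul_of_nonneg_left hkge hn0.le
      linarith
    have h2 : n ^ (7 / 8 : ℝ) ≤ 8 / lam * (n * L / Real.log n) := by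
      have h3 : Real.log n ≤ n ^ (1 / 8 : ℝ) / (1 / 8) :=
        Real.log_le_rpow_div hn0.le (by norm_num)
      have h4 : n ^ (7 / 8 : ℝ) * n ^ (1 / 8 : ℝ) = n := by
        rw [← Real.rpow_add hn0]; norm_num
      have h5 : n ^ (7 / 8 : ℝ) * Real.log n ≤ 8 * n := by
        have := mul_le_mul_of_nonneg_left h3 (Real.rpow_nonneg hn0.le (7 / 8))
        linarith
      rw [div_mul_div_comm, le_div_iff₀ (by positivity)]
      have h6 : lam * (n ^ (7 / 8 : ℝ) * Real.log n) ≤ L * (8 * n) := by gcongr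
      linarith
    have h3 : n * L / Real.log n ≤ 2 * (n * L / (Real.log n + L)) := by
      rw [← mul_div_assoc, div_le_div_iff₀ hlogpos (by linarith)]
      have := mul_le_mul_of_nonneg_left (show Real.log n + L ≤ 2 * Real.log n by linarith)
        (show 0 ≤ n * L by positivity)
      linarith
    calc n / k + n ^ (7 / 8 : ℝ) ≤ (16 * D + 8 / lam) * (n * L / Real.log n) := by linarith
      _ ≤ (16 * D + 8 / lam) * (2 * (n * L / (Real.log n + L))) := by gcongr
      _ = (32 * D + 16 / lam) * (n * L / (Real.log n + L)) := by ring

/-! ### The minrank of the random digraph -/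

theorem theorem3p7 (ε : ℝ) (hε : 0 < ε) :
    ∃ C c : ℝ, 0 < C ∧ 0 < c ∧
      ∀ (F : Type*) [Field F] (n : ℕ) (p : unitInterval),
        1 ≤ n → 0 < (p : ℝ) → (p : ℝ) ≤ 1 - ε →
          1 - Real.exp (-(c * n)) ≤
            (directedGnp n p).real {G : Digraph (Fin n) |
              (minrank F G : ℝ) ≤
                C * (n * Real.log (1 / p) / (Real.log n + Real.log (1 / p)))} := by
  rcases le_or_gt 1 ε with hε1 | hε1
  -- No `p` satisfies `0 < p ≤ 1 - ε` here.
  · exact ⟨1, 1, one_pos, one_pos, fun F _ n p _ hp hp' ↦ absurd hp (by linarith)⟩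
  obtain ⟨lam, hlam_def⟩ : ∃ lam, lam = Real.log (1 / (1 - ε)) := ⟨_, rfl⟩
  have hlam : 0 < lam := hlam_def ▸ Real.log_pos (by rw [lt_div_iff₀] <;> linarith)
  obtain ⟨D, hD⟩ : ∃ D, D = 2 + Real.log 16 / lam := ⟨_, rfl⟩
  have hD0 : 0 < D := by
    have : 0 ≤ Real.log 16 / lam := div_nonneg (Real.log_nonneg (by norm_num)) hlam.le
    linarith
  obtain ⟨N, hN⟩ : ∃ N : ℝ, N = Real.log (2 ^ 14) / lam := ⟨_, rfl⟩
  have hN0 : 0 ≤ N := hN ▸ div_nonneg (Real.log_nonneg (by norm_num)) hlam.le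
  -- The three summands serve small `n`, small `p` and the remaining range, respectively.
  obtain ⟨C, hC⟩ : ∃ C, C = (N + 1) + (8 * D + 1) + (32 * D + 16 / lam) := ⟨_, rfl⟩
  have hlam16 : 0 < 16 / lam := by positivity
  refine ⟨C, 1, by linarith, one_pos, fun F _ n p hn hp hpε ↦ ?_⟩
  obtain ⟨L, hL_def⟩ : ∃ L, L = Real.log (1 / p) := ⟨_, rfl⟩
  rw [← hL_def, one_mul]
  have hn0 : (0 : ℝ) < n := by exact_mod_cast hn
  have hlogn : 0 ≤ Real.log n := Real.log_natCast_nonneg n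
  have hlamL : lam ≤ L := by
    rw [hlam_def, hL_def]
    exact Real.log_le_log (by apply div_pos <;> linarith) (one_div_le_one_div_of_le hp hpε)
  have hL : 0 < L := hlam.trans_le hlamL
  have hratio : 0 ≤ n * L / (Real.log n + L) := by positivity
  have htriv {C' : ℝ} (hC' : C' ≤ C) (h : Real.log n + L ≤ C' * L) : 1 - Real.exp (-n) ≤
      (directedGnp n p).real {G : Digraph (Fin n) |
        (minrank F G : ℝ) ≤ C * (n * L / (Real.log n + L))} := by
    have : {G : Digraph (Fin n) | (minrank F G : ℝ) ≤ C * (n * L / (Real.log n + L))}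
        = Set.univ := by
      refine Set.eq_univ_of_forall fun G ↦ ?_
      have h1 : (minrank F G : ℝ) ≤ n := by
        exact_mod_cast (minrank_le_card F G).trans_eq (Fintype.card_fin n)
      refine h1.trans (le_trans ?_ (mul_le_mul_of_nonneg_right hC' hratio))
      rw [← mul_div_assoc, le_div_iff₀ (by linarith)]
      have := mul_le_mul_of_nonneg_left h hn0.le
      linarith
    rw [this, probReal_univ]
    linarith [Real.exp_pos (-(n : ℝ))]
  by_cases hnN : (n : ℝ) ≤ 2 ^ 14
  · refine htriv (C' := N + 1) (by linarith) ?_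
    have h1 : Real.log n ≤ Real.log (2 ^ 14) := Real.log_le_log hn0 hnN
    have h2 : Real.log (2 ^ 14) = N * lam := by rw [hN, div_mul_cancel₀ _ hlam.ne']
    have h3 := mul_le_mul_of_nonneg_left hlamL hN0
    linarith
  by_cases hnp : Real.log n < 8 * D * L
  · exact htriv (C' := 8 * D + 1) (by linarith) (by linarith)
  push Not at hnN hnp
  obtain ⟨m, s₀, k, hm, hk, hpm, hs₀, hbound⟩ :=
    exists_greedy_parameters hlam hlamL hD hnN.le hnp
  have hpL : Real.exp (-L) = p := by
    rw [hL_def, one_div, Real.log_inv, neg_neg, Real.exp_log hp]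
  rw [hpL] at hpm hs₀
  rw [directedGnp, map_measureReal_apply Measurable.of_discrete MeasurableSpace.measurableSet_top]
  refine (setBernoulli_real_isMutuallyDense_ge p hm hpm).trans (measureReal_mono fun A hA ↦ ?_)
  refine (IsMutuallyDense.minrank_le F hA (by positivity) (pow_le_one₀ p.2.1 p.2.2) hm hk
    hs₀).trans (hbound.trans (mul_le_mul_of_nonneg_right ?_ hratio))
  linarith
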